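/- **Model.** There are $n$ processes $p_1,\dots,p_n$ in a synchronous network: in each round a process sends messages, receives the messages sent to it in that round (each with the true identity of its sender, in arbitrary order), and updates its state. A set $F$ of at most $t$ processes is faulty, $H$ is the set of the other, honest, processes. Honest processes follow the algorithm; faulty ones may send arbitrary messages, even after seeing the honest messages of the current round, but they cannot forge signatures: a signature of an honest process that occurs in a message of a faulty process must occur in a message that the honest process itself has already sent (in the same round at the latest). To broadcast is to send to all $n$ processes, including oneself; it counts as $n$ messages. Values come from a linearly ordered set. Each process $p_i$ has an input value $x_i$, the numbers $n,t,k\ge 0$, and a classification vector $c_i\in\{0,1\}^n$ ($c_i[j]=1$: $p_i$ classifies $p_j$ as honest). A process $p_j$ is misclassified if for some honest $p_i$ either $p_j$ is honest and $c_i[j]=0$, or $p_j$ is faulty and $c_i[j]=1$. Let $\pi(c_i)$ list first the $j$ with $c_i[j]=1$ in increasing order, then the $j$ with $c_i[j]=0$ in increasing order. A committee certificate for $p_j$ is a set of signatures of $\langle\mathrm{COMMITTEE},p_j\rangle$ by $t+1$ different processes. A message chain of length $1$ for $x$ started by $p_i$ is $\langle x,cc,\mathsf{sign}_i(\langle x,cc\rangle)\rangle$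 with $cc$ a committee certificate for $p_i$; if $m$ is a message chain of length $b$ and $cc$ is a committee certificate for $p_j$, then $\langle m,cc,\mathsf{sign}_j(\langle m,cc\rangle)\rangle$ is a message chain of length $b+1$ with the same value and starter as $m$. A chain is valid if its signers are pairwise different. **Algorithm** (code of $p_i$). * Round 1: send $\mathsf{sign}_i(\langle\mathrm{COMMITTEE},p_j\rangle)$ to $p_j$ for every $j$ among the first $2k+1$ entries of $\pi(c_i)$ (all entries if there are fewer). Let $S_i$ be the set of the $j$ such that $p_j$ sent $\mathsf{sign}_j(\langle\mathrm{COMMITTEE},p_i\rangle)$ to $p_i$. If $|S_i|\ge t+1$, let $cc_i$ consist of these signatures for the $t+1$ smallest $j\in S_i$ (a committee certificate for $p_i$); otherwise $cc_i=\emptyset$. * Rounds $2,\dots,k+2$: run, for all $s\in\{1,\dots,n\}$ in parallel, the following broadcast instance with sender $p_s$, which takes $k+1$ rounds. Start with $X_i=\emptyset$; if $i=s$ and $cc_i$ is a committee certificate, put $X_i=\{x_i\}$ and broadcast in its round 1 the chain $\langle x_i,cc_i,\mathsf{sign}_i(\langle x_i,cc_i\rangle)\rangle$. For $b=1,\dots,k+1$,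 go through the valid message chains $m$ of length $b$ started by $p_s$ that were received in round $b$ of the instance; whenever the value of $m$ is not in $X_i$ and $|X_i|<2$, add it to $X_i$ and, if $b\le k$ and $cc_i$ is a committee certificate, broadcast $\langle m,cc_i,\mathsf{sign}_i(\langle m,cc_i\rangle)\rangle$ in the next round. At the end let $bb_i[s]=x$ if $X_i=\{x\}$, and $bb_i[s]=\bot$ otherwise. * Round $k+3$: if $cc_i$ is a committee certificate, broadcast $\langle plurality_i,cc_i\rangle$, where $plurality_i$ is the smallest value other than $\bot$ that occurs the largest number of times in $bb_i$ (if all entries are $\bot$, nothing is sent). Let $V_i$ be the multiset that contains, for each $p_j$ from which $p_i$ received some $\langle v,cc\rangle$ with $cc$ a committee certificate for $p_j$, one such value $v$ (the first one received). Return the smallest value that occurs the largest number of times in $V_i$ ($\bot$ if $V_i$ is empty). **Theorem.** There is an absolute constant $C$ such that the following holds in every execution of this algorithm with at most $t$ faulty processes. 1. If at most $k$ processes are misclassified, $2k+1\le n-t-k$ and $t<n/2$, then the algorithm solves Byzantine agreement: all honest processes return the same value $v\neq\bot$ (at the end of round $k+3$), and if all honest processes have the same input value, they return this value. Moreover, the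 honest processes send at most $C\,n\,\max(k,1)^2$ messages in total, that is, $O(nk^2)$ for $k\ge1$. 2. In every case, that is, even without the assumptions of part 1, each honest process returns exactly at the end of round $k+3$ and sends at most $C\,n^2$ messages. -/

import Mathlib

universe u

/-! ## Synchronous message passing with Byzantine faults and signatures -/

namespace SyncNet

/-- The code of a deterministic synchronous protocol for `n` parties, identified by `Fin n`. In each
round a party first sends messages, given as a list of pairs (recipient, message), computed from its
current state; then it gets its inbox, a list of pairs (sender, message), and updates its state.
`output s = some o` means that a party in state `s` has returned `o`. -/
structure Protocol (n : ℕ) (Msg State Out : Type u) where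
  start : Fin n → State
  send : Fin n → State → List (Fin n × Msg)
  receive : Fin n → State → List (Fin n × Msg) → State
  output : State → Option Out

/-- An execution of `P` in which exactly the parties in `F` are faulty. Messages contain signatures,
and `signer σ` is the owner of the key that created `σ`.

* `state r i` is the state of party `i` after `r` rounds;
* `sent r i` lists the messages (with recipients) that `i` sends in round `r + 1`;
* `inbox r i` lists the messages (with senders) that `i` receives in round `r + 1`.

Honest parties follow `P`. Everything sent to an honest party is delivered in the same round, with the
true identity of the sender, in an arbitrary order. Faulty parties send arbitrary messages (they may
even see what the honest parties send in the same round), except that they cannot forge: a signature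
of an honest party that occurs in a message of a faulty party must occur in a message which the honest
party itself has sent, in the same round at the latest. -/
structure Execution {n : ℕ} {Msg State Out Sig : Type u} (P : Protocol n Msg State Out)
    (F : Finset (Fin n)) (signatures : Msg → Set Sig) (signer : Sig → Fin n) where
  state : ℕ → Fin n → State
  sent : ℕ → Fin n → List (Fin n × Msg)
  inbox : ℕ → Fin n → List (Fin n × Msg)
  state_zero : ∀ i, i ∉ F → state 0 i = P.start i
  sent_honest : ∀ r i, i ∉ F → sent r i = P.send i (state r i)
  state_succ : ∀ r i, i ∉ F → state (r + 1) i = P.receive i (state r i) (inbox r i)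
  delivery : ∀ r i, i ∉ F → (inbox r i).Perm
    ((List.finRange n).flatMap fun j =>
      ((sent r j).filter fun p => p.1 = i).map fun p => (j, p.2))
  unforgeable : ∀ r i, i ∈ F → ∀ p ∈ sent r i, ∀ σ ∈ signatures p.2, signer σ ∉ F →
    ∃ r' ≤ r, ∃ q ∈ sent r' (signer σ), σ ∈ signatures q.2

namespace Execution

variable {n : ℕ} {Msg State Out Sig : Type u} {P : Protocol n Msg State Out}
  {F : Finset (Fin n)} {signatures : Msg → Set Sig} {signer : Sig → Fin n}

/-- Party `i` returns `o` exactly at the end of round `r`. -/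
def ReturnsAt (E : Execution P F signatures signer) (i : Fin n) (r : ℕ) (o : Out) : Prop :=
  (∀ r' < r, P.output (E.state r' i) = none) ∧ ∀ r' ≥ r, P.output (E.state r' i) = some o

/-- The number of messages that party `i` sends in the first `R` rounds
(a message sent to `m` recipients counts `m` times). -/
def messagesSent (E : Execution P F signatures signer) (i : Fin n) (R : ℕ) : ℕ :=
  ∑ r ∈ Finset.range R, (E.sent r i).length

end Execution

end SyncNet

/-! ## Authenticated Byzantine agreement with classification -/

namespace AuthBA

open SyncNet

section Classification

variable {n : ℕ}

/-- The parties that are misclassified by some honest party: `c i j = true` means that `i` classifies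
`j` as honest. -/
def misclassified (F : Finset (Fin n)) (c : Fin n → Fin n → Bool) : Finset (Fin n) :=
  Finset.univ.filter fun j =>
    ∃ i, i ∉ F ∧ ((j ∉ F ∧ c i j = false) ∨ (j ∈ F ∧ c i j = true))

/-- The ordering `π(c)`: first the identifiers classified as honest, then those classified as faulty,
each group in increasing order. -/
def order (c : Fin n → Bool) : List (Fin n) :=
  ((List.finRange n).filter fun j => c j = true) ++ (List.finRange n).filter fun j => c j = false

end Classification

section Messages

/-- A finite set of signatures for committee messages; the pair `(a, b)` stands for
`sign_a(⟨COMMITTEE, p_b⟩)`. -/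
abbrev Cert (n : ℕ) : Type := Finset (Fin n × Fin n)

/-- `cc` is a committee certificate for `p_j`: a set of signatures for `⟨COMMITTEE, p_j⟩` by `t + 1`
different parties. -/
def IsCert {n : ℕ} (t : ℕ) (j : Fin n) (cc : Cert n) : Prop :=
  cc.card = t + 1 ∧ ∀ σ ∈ cc, σ.2 = j

instance {n : ℕ} (t : ℕ) (j : Fin n) (cc : Cert n) : Decidable (IsCert t j cc) :=
  inferInstanceAs (Decidable (_ ∧ _))

/-- `start x cc i` is `⟨x, cc, sign_i(⟨x, cc⟩)⟩` and `extend m cc j` is `⟨m, cc, sign_j(⟨m, cc⟩)⟩`.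
No condition is put on the certificates here, see `Chain.Valid`. -/
inductive Chain (n : ℕ) (V : Type u) : Type u
  | start (x : V) (cc : Cert n) (i : Fin n) : Chain n V
  | extend (m : Chain n V) (cc : Cert n) (j : Fin n) : Chain n V

namespace Chain

variable {n : ℕ} {V : Type u}

/-- The value of the chain. -/
def value : Chain n V → V
  | start x _ _ => x
  | extend m _ _ => m.value

/-- The party that started the chain. -/
def starter : Chain n V → Fin n
  | start _ _ i => i
  | extend m _ _ => m.starter

/-- The successive signers of the chain, each with the certificate attached at that step. -/
def links : Chain n V → List (Fin n × Cert n)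
  | start _ cc i => [(i, cc)]
  | extend m cc j => m.links ++ [(j, cc)]

/-- The length of the chain. -/
def length (m : Chain n V) : ℕ := m.links.length

/-- The chain is a valid message chain: each attached certificate is a committee certificate for the
party that signed at that step, and the signers are pairwise different. -/
def Valid (t : ℕ) (m : Chain n V) : Prop :=
  (∀ l ∈ m.links, IsCert t l.1 l.2) ∧ (m.links.map Prod.fst).Nodup

instance (t : ℕ) (m : Chain n V) : Decidable (m.Valid t) :=
  @instDecidableAnd _ _ (List.decidableBAll _ m.links) inferInstance

end Chain

/-- The signatures: `committee a b` is `sign_a(⟨COMMITTEE, p_b⟩)`, `start i x cc` is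
`sign_i(⟨x, cc⟩)`, and `extend i m cc` is `sign_i(⟨m, cc⟩)`. -/
inductive Signature (n : ℕ) (V : Type u) : Type u
  | committee (a b : Fin n) : Signature n V
  | start (i : Fin n) (x : V) (cc : Cert n) : Signature n V
  | extend (i : Fin n) (m : Chain n V) (cc : Cert n) : Signature n V

/-- The party whose signature it is. -/
def Signature.signer {n : ℕ} {V : Type u} : Signature n V → Fin n
  | committee a _ => a
  | start i _ _ => i
  | extend i _ _ => i

/-- The messages that honest parties send or react to: a committee signature
`sign_a(⟨COMMITTEE, p_b⟩)`, a chain, or a pair `⟨v, cc⟩`. (Other messages are ignored by every honest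
party, so they are left out.) -/
inductive Message (n : ℕ) (V : Type u) : Type u
  | vote (a b : Fin n) : Message n V
  | chain (m : Chain n V) : Message n V
  | plurality (v : V) (cc : Cert n) : Message n V

variable {n : ℕ} {V : Type u}

/-- The signatures contained in a set of committee signatures. -/
def Cert.signatures (cc : Cert n) : Set (Signature n V) :=
  {σ | ∃ p ∈ cc, σ = Signature.committee p.1 p.2}

/-- All signatures that occur in a chain. -/
def Chain.signatures : Chain n V → Set (Signature n V)
  | start x cc i => insert (Signature.start i x cc) (Cert.signatures cc)
  | extend m cc j => insert (Signature.extend j m cc) (Cert.signatures cc ∪ m.signatures)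

/-- All signatures that occur in a message. -/
def Message.signatures : Message n V → Set (Signature n V)
  | vote a b => {Signature.committee a b}
  | chain m => m.signatures
  | plurality _ cc => Cert.signatures cc

end Messages

section Code

variable {n : ℕ} {V : Type u}

/-- The smallest value that occurs the largest number of times in the multiset `M`
(`none` if `M` is empty). -/
def smallestMode [LinearOrder V] (M : Multiset V) : Option V :=
  let S := M.toFinset.filter fun v => ∀ w ∈ M.toFinset, M.count w ≤ M.count v
  if h : S.Nonempty then some (S.min' h) else none

/-- Send the message to every party, including oneself. -/
def broadcast (m : Message n V) : List (Fin n × Message n V) :=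
  (List.finRange n).map fun j => (j, m)

/-- The chains among the received messages, in the order of the inbox. -/
def receivedChains (inb : List (Fin n × Message n V)) : List (Chain n V) :=
  inb.filterMap fun p => match p.2 with
    | .chain m => some m
    | _ => none

/-- The loop over the received chains in the broadcast instance with sender `s`: a valid chain of
length `len` started by `s` whose value is not in `X` is accepted, and its value is added to `X`, as
long as `X` has fewer than two elements. The result is the new set `X` and the list of the accepted
chains. -/
def acceptChains [DecidableEq V] (t len : ℕ) (s : Fin n) :
    Finset V → List (Chain n V) → Finset V × List (Chain n V)
  | X, [] => (X, [])
  | X, m :: ms =>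
    if m.Valid t ∧ m.length = len ∧ m.starter = s ∧ m.value ∉ X ∧ X.card < 2 then
      let res := acceptChains t len s (insert m.value X) ms
      (res.1, m :: res.2)
    else acceptChains t len s X ms

/-- The result of a broadcast instance: `x` if `X = {x}`, and `⊥` (that is, `none`) otherwise. -/
def bbResult [LinearOrder V] (X : Finset V) : Option V :=
  if h : X.card = 1 then some (X.min' (Finset.card_pos.mp (by omega))) else none

/-- The identifiers `j` of the parties `p_j` that sent `sign_j(⟨COMMITTEE, p_i⟩)` to `p_i`. -/
def voters (i : Fin n) (inb : List (Fin n × Message n V)) : Finset (Fin n) :=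
  (inb.filterMap fun p => match p.2 with
    | .vote a b => if a = p.1 ∧ b = i then some p.1 else none
    | _ => none).toFinset

/-- The set `cc_i` computed from the set `S` of voters for `p_i`: the signatures of the `t + 1` smallest
identifiers in `S` if there are that many, and the empty set otherwise. -/
def makeCert (t : ℕ) (i : Fin n) (S : Finset (Fin n)) : Cert n :=
  if t + 1 ≤ S.card then
    (((List.finRange n).filter fun j => j ∈ S).take (t + 1)).toFinset.image fun j => (j, i)
  else ∅

/-- The value received from `p_j` together with a committee certificate for `p_j` (the first one in the
inbox, should a faulty `p_j` have sent several; `none` if there is none). -/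
def pluralityFrom (t : ℕ) (inb : List (Fin n × Message n V)) (j : Fin n) : Option V :=
  (inb.filterMap fun p => match p.2 with
    | .plurality v cc => if p.1 = j ∧ IsCert t j cc then some v else none
    | _ => none).head?

/-- The local state of a party: the number of completed rounds, the set `cc_i`, the set `X_i` of each
of the `n` parallel broadcast instances, the messages to be sent in the next round, and the returned
value once the party has returned. The returned value `none` stands for `⊥`; it is returned only if no
value at all was received in the last round. -/
structure State (n : ℕ) (V : Type u) : Type u where
  round : ℕ
  cc : Cert n
  X : Fin n → Finset V
  outbox : List (Fin n × Message n V)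
  result : Option (Option V)

/-- Before round 1: prepare the signatures for the first `2k + 1` identifiers of `π(c_i)`. -/
def startState (k : ℕ) (c : Fin n → Bool) (i : Fin n) : State n V where
  round := 0
  cc := ∅
  X := fun _ => ∅
  outbox := ((order c).take (2 * k + 1)).map fun j => (j, .vote i j)
  result := none

/-- End of round 1: compute `cc_i`, and begin the `n` broadcast instances: the party whose own
certificate is complete starts a chain for its input value `x` in the instance of which it is the
sender. -/
def afterVotes (t : ℕ) (x : V) (i : Fin n) (st : State n V)
    (inb : List (Fin n × Message n V)) : State n V :=
  let cc := makeCert t i (voters i inb)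
  { st with
    round := st.round + 1
    cc := cc
    X := fun s => if s = i ∧ IsCert t i cc then {x} else ∅
    outbox := if IsCert t i cc then broadcast (.chain (.start x cc i)) else [] }

/-- End of round `len` of the broadcast instances, `1 ≤ len ≤ k`: process the chains of length `len` and,
if in possession of a committee certificate, extend and broadcast the accepted ones. -/
def afterRelay [DecidableEq V] (t : ℕ) (i : Fin n) (st : State n V)
    (inb : List (Fin n × Message n V)) : State n V :=
  let res := fun s => acceptChains t st.round s (st.X s) (receivedChains inb)
  { st with
    round := st.round + 1
    X := fun s => (res s).1
    outbox := if IsCert t i st.cc then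
        (List.finRange n).flatMap fun s =>
          (res s).2.flatMap fun m => broadcast (.chain (.extend m st.cc i))
      else [] }

/-- End of round `k + 1` of the broadcast instances: process the chains of length `k + 1`, compute the
results `bb_i` and, if in possession of a committee certificate, broadcast the smallest value other
than `⊥` that occurs the largest number of times in `bb_i`. -/
def afterLastRelay [LinearOrder V] (t : ℕ) (i : Fin n) (st : State n V)
    (inb : List (Fin n × Message n V)) : State n V :=
  let X := fun s => (acceptChains t st.round s (st.X s) (receivedChains inb)).1
  let bb := fun s => bbResult (X s)
  { st with
    round := st.round + 1
    X := X
    outbox := if IsCert t i st.cc then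
        match smallestMode (((List.finRange n).filterMap bb : List V) : Multiset V) with
        | some v => broadcast (.plurality v st.cc)
        | none => []
      else [] }

/-- End of the last round: return the smallest value that occurs the largest number of times among the
values received from parties with a committee certificate. -/
def afterPlurality [LinearOrder V] (t : ℕ) (st : State n V)
    (inb : List (Fin n × Message n V)) : State n V :=
  { st with
    round := st.round + 1
    outbox := []
    result := some
      (smallestMode (((List.finRange n).filterMap (pluralityFrom t inb) : List V) : Multiset V)) }

/-- The authenticated Byzantine agreement algorithm with classification, for at most `t` faults, bound
`k` on the number of misclassified parties, input values `x` and classification vectors `c`. -/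
def algorithm [LinearOrder V] (t k : ℕ) (x : Fin n → V) (c : Fin n → Fin n → Bool) :
    Protocol n (Message n V) (State n V) (Option V) where
  start := fun i => startState k (c i) i
  send := fun _ st => st.outbox
  receive := fun i st inb =>
    if st.round = 0 then afterVotes t (x i) i st inb
    else if st.round ≤ k then afterRelay t i st inb
    else if st.round = k + 1 then afterLastRelay t i st inb
    else if st.round = k + 2 then afterPlurality t st inb
    else { st with round := st.round + 1 }
  output := fun st => st.result

end Code

end AuthBA

namespace AuthBA

open SyncNet

/-! ### Counting in sorted lists, modes of multisets, results of broadcast instances -/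

section Lists

/-! The votes of round 1 elect a small committee with more honest than faulty members. At least
`2k+1` honest parties are trusted by all honest parties. So an honest party votes only for
identifiers it trusts: well classified ones, which then lie among the `2k+1` smallest of that kind,
or misclassified ones. Hence at most `3k+1` parties are nominated by honest parties, at most `k` of
them faulty (`card_nominated_le`, `card_nominated_inter_le`). The `k+1` smallest well classified
parties are preceded by too few others to be cut off, so every honest party votes for them
(`exists_core`), and `t < n/2` turns these votes into certificates. Conversely, a certificate
contains an honest vote, and since honest signatures arise only from the code (`legit_sent`), its
owner is nominated.

Among certificate holders the broadcast is that of Dolev and Strong. A chain of length `k+1` has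
`k+1` different nominated signers, so one is honest and has already spread the value; a shorter
chain is relayed by the holder that accepts it. Keeping only two values is harmless, because two
values already mean `⊥`. So all honest holders obtain the same vector and the same plurality
(`mem_X_of_mem_X`, `bbResult_eq`). In the last round the `k+1` core members outvote the at most `k`
faulty nominees; the same count applied to the vector gives unanimity (`agreement`).

For the message count, every chain broadcast is charged to a new element of some `X_i[s]`, which has
at most two elements and is empty unless `s` is nominated (`messagesSent_add_outbox_le`). Under the
classification bounds there are at most `3k+1` holders and `3k+1` active instances; in general there
are at most `n` instances. -/

theorem mem_take_filter_finRange {n : ℕ} (p : Fin n → Bool) (m : ℕ) (j : Fin n) :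
    j ∈ ((List.finRange n).filter p).take m ↔
      p j = true ∧ (Finset.univ.filter fun l => p l = true ∧ l < j).card < m := by
  -- In a strictly increasing list the position of an element is the number of smaller entries; this
  -- turns truncation into a cardinality.
  have key : ∀ (L : List (Fin n)), L.Pairwise (· < ·) → ∀ m : ℕ,
      (j ∈ L.take m ↔ j ∈ L ∧ (L.filter fun l => l < j).length < m) := by
    intro L
    induction L with
    | nil => simp
    | cons a L ih =>
      intro hL m
      rw [List.pairwise_cons] at hL
      cases m with
      | zero => simp
      | succ m =>
        rw [List.take_succ_cons, List.mem_cons, List.mem_cons, ih hL.2 m]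
        by_cases hja : j = a
        · subst hja
          have : (L.filter fun l => l < j) = [] := by
            rw [List.filter_eq_nil_iff]
            intro b hb
            simpa using (hL.1 b hb).le
          simp [this]
        · simp only [hja, false_or]
          constructor
          · rintro ⟨h1, h2⟩
            refine ⟨h1, ?_⟩
            rw [List.filter_cons]
            split <;> simp <;> omega
          · rintro ⟨h1, h2⟩
            refine ⟨h1, ?_⟩
            rw [List.filter_cons_of_pos (by simpa using hL.1 j h1)] at h2
            simpa using h2
  have hsorted : ((List.finRange n).filter p).Pairwise (· < ·) :=
    (List.pairwise_lt_finRange n).filter _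
  rw [key _ hsorted m]
  have hlen : ((((List.finRange n).filter p).filter fun l => l < j)).length =
      (Finset.univ.filter fun l => p l = true ∧ l < j).card := by
    have hnd : (((List.finRange n).filter p).filter fun l => l < j).Nodup :=
      ((List.nodup_finRange n).filter _).filter _
    rw [← List.toFinset_card_of_nodup hnd]
    congr 1
    ext l
    simp [and_comm]
  rw [hlen]
  simp

theorem count_filterMap_finRange {n : ℕ} {V : Type u} [DecidableEq V] (f : Fin n → Option V)
    (v : V) :
    Multiset.count v (((List.finRange n).filterMap f : List V) : Multiset V) =
      (Finset.univ.filter fun j => f j = some v).card := by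
  rw [Multiset.coe_count, List.count_filterMap, List.countP_eq_length_filter]
  rw [← List.toFinset_card_of_nodup ((List.nodup_finRange n).filter _)]
  congr 1
  ext j
  simp

theorem smallestMode_eq_some {V : Type u} [LinearOrder V] {M : Multiset V} {w : V}
    (h : ∀ v, v ≠ w → M.count v < M.count w) (hw : w ∈ M) : smallestMode M = some w := by
  have hS : (M.toFinset.filter fun v => ∀ u ∈ M.toFinset, M.count u ≤ M.count v) = {w} := by
    ext v
    simp only [Finset.mem_filter, Multiset.mem_toFinset, Finset.mem_singleton]
    constructor
    · rintro ⟨-, hv⟩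
      by_contra hne
      exact absurd (hv w hw) (not_le.2 (h v hne))
    · rintro rfl
      refine ⟨hw, fun u _ => ?_⟩
      by_cases hu : u = v
      · rw [hu]
      · exact (h u hu).le
  unfold smallestMode
  simp only [hS]
  simp

theorem exists_smallestMode {V : Type u} [LinearOrder V] {M : Multiset V} {w : V}
    (hw : w ∈ M) : ∃ v, smallestMode M = some v := by
  have hS : (M.toFinset.filter fun v => ∀ u ∈ M.toFinset, M.count u ≤ M.count v).Nonempty := by
    obtain ⟨v, hv, hmax⟩ := M.toFinset.exists_max_image (fun v => M.count v)
      ⟨w, Multiset.mem_toFinset.2 hw⟩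
    exact ⟨v, Finset.mem_filter.2 ⟨hv, hmax⟩⟩
  unfold smallestMode
  simp only [hS, dite_true]
  exact ⟨_, rfl⟩

/-- A value held by more than `k` positions, while all other values come from a set of at most `k`
positions, is the mode. -/
theorem smallestMode_filterMap_eq {n k : ℕ} {V : Type u} [LinearOrder V] (f : Fin n → Option V)
    (w : V) (A B : Finset (Fin n)) (hA : ∀ j ∈ A, f j = some w) (hAk : k < A.card)
    (hB : ∀ j v, f j = some v → v ≠ w → j ∈ B) (hBk : B.card ≤ k) :
    smallestMode (((List.finRange n).filterMap f : List V) : Multiset V) = some w := by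
  have hw : A.card ≤ (Finset.univ.filter fun j => f j = some w).card :=
    Finset.card_le_card fun j hj => by simpa using hA j hj
  apply smallestMode_eq_some
  · intro v hv
    rw [count_filterMap_finRange, count_filterMap_finRange]
    have : (Finset.univ.filter fun j => f j = some v).card ≤ B.card :=
      Finset.card_le_card fun j hj => hB j v (by simpa using hj) hv
    omega
  · rw [← Multiset.count_pos, count_filterMap_finRange]
    omega

theorem bbResult_eq_some_iff {V : Type u} [LinearOrder V] {X : Finset V} {v : V} :
    bbResult X = some v ↔ X = {v} := by
  unfold bbResult
  constructor
  · intro h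
    split at h
    · rename_i hc
      obtain ⟨a, rfl⟩ := Finset.card_eq_one.1 hc
      simpa using h
    · simp at h
  · rintro rfl
    simp

/-- Sets that agree up to overflow give the same result. -/
theorem bbResult_congr {V : Type u} [LinearOrder V] {X Y : Finset V}
    (hXY : ∀ v ∈ X, v ∈ Y ∨ 2 ≤ Y.card) (hYX : ∀ v ∈ Y, v ∈ X ∨ 2 ≤ X.card) :
    bbResult X = bbResult Y := by
  have key : ∀ {X Y : Finset V}, (∀ v ∈ X, v ∈ Y ∨ 2 ≤ Y.card) →
      (∀ v ∈ Y, v ∈ X ∨ 2 ≤ X.card) → ∀ v, X = {v} → Y = {v} := by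
    rintro X Y h1 h2 v rfl
    -- A singleton has not overflowed, so it contains all of `Y`; then `Y` has not overflowed either
    -- and must contain `v`.
    have hsub : Y ⊆ {v} := fun w hw => by
      rcases h2 w hw with h | h
      · exact h
      · simp at h
    rcases h1 v (Finset.mem_singleton_self v) with h | h
    · exact Finset.Subset.antisymm hsub (Finset.singleton_subset_iff.2 h)
    · have := Finset.card_le_card hsub
      simp at this
      omega
  apply Option.ext
  intro v
  rw [bbResult_eq_some_iff, bbResult_eq_some_iff]
  exact ⟨key hXY hYX v, key hYX hXY v⟩

end Lists

/-! ### The loop that accepts chains -/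

section Accept

variable {n : ℕ} {V : Type u} [DecidableEq V] {t len : ℕ} {s : Fin n}

/-- A chain is accepted only for a new value. This equality lets the message count charge each
relayed chain to an element of `X`. -/
theorem acceptChains_card (ms : List (Chain n V)) : ∀ X : Finset V,
    (acceptChains t len s X ms).1.card = X.card + (acceptChains t len s X ms).2.length := by
  induction ms with
  | nil => intro X; simp [acceptChains]
  | cons m ms ih =>
    intro X
    rw [acceptChains]
    split
    · rename_i h
      simp only [ih, Finset.card_insert_of_notMem h.2.2.2.1, List.length_cons]
      omega
    · exact ih X

theorem acceptChains_card_le (ms : List (Chain n V)) : ∀ X : Finset V, X.card ≤ 2 →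
    (acceptChains t len s X ms).1.card ≤ 2 := by
  induction ms with
  | nil => intro X h; simpa [acceptChains] using h
  | cons m ms ih =>
    intro X hX
    rw [acceptChains]
    split
    · rename_i h
      refine ih _ ?_
      rw [Finset.card_insert_of_notMem h.2.2.2.1]
      omega
    · exact ih X hX

theorem subset_acceptChains (ms : List (Chain n V)) : ∀ X : Finset V,
    X ⊆ (acceptChains t len s X ms).1 := by
  induction ms with
  | nil => intro X; simp [acceptChains]
  | cons m ms ih =>
    intro X
    rw [acceptChains]
    split
    · exact (Finset.subset_insert _ _).trans (ih _)
    · exact ih X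

theorem mem_acceptChains (ms : List (Chain n V)) : ∀ (X : Finset V) (m : Chain n V),
    m ∈ (acceptChains t len s X ms).2 →
      m ∈ ms ∧ m.Valid t ∧ m.length = len ∧ m.starter = s ∧ m.value ∉ X ∧
        m.value ∈ (acceptChains t len s X ms).1 := by
  induction ms with
  | nil => intro X m h; simp [acceptChains] at h
  | cons a ms ih =>
    intro X m
    rw [acceptChains]
    split
    · rename_i h
      intro hm
      rcases List.mem_cons.1 hm with rfl | hm
      · exact ⟨List.mem_cons_self, h.1, h.2.1, h.2.2.1, h.2.2.2.1,
          subset_acceptChains ms _ (Finset.mem_insert_self _ _)⟩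
      · obtain ⟨h1, h2, h3, h4, h5, h6⟩ := ih _ m hm
        exact ⟨List.mem_cons_of_mem _ h1, h2, h3, h4,
          fun h' => h5 (Finset.mem_insert_of_mem h'), h6⟩
    · intro hm
      obtain ⟨h1, h2⟩ := ih X m hm
      exact ⟨List.mem_cons_of_mem _ h1, h2⟩

theorem mem_acceptChains_fst (ms : List (Chain n V)) : ∀ (X : Finset V) (v : V),
    v ∈ (acceptChains t len s X ms).1 →
      v ∈ X ∨ ∃ m ∈ (acceptChains t len s X ms).2, m.value = v := by
  induction ms with
  | nil => intro X v h; left; simpa [acceptChains] using h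
  | cons a ms ih =>
    intro X v
    rw [acceptChains]
    split
    · intro hv
      rcases ih _ v hv with h | ⟨m, hm, h⟩
      · rcases Finset.mem_insert.1 h with rfl | h
        · exact Or.inr ⟨a, List.mem_cons_self, rfl⟩
        · exact Or.inl h
      · exact Or.inr ⟨m, List.mem_cons_of_mem _ hm, h⟩
    · exact ih X v

/-- A valid chain is skipped only if its value is present or `X` is full, and `X` never shrinks. The
second alternative is the one that `bbResult_congr` tolerates. -/
theorem value_mem_acceptChains (ms : List (Chain n V)) : ∀ (X : Finset V) (m : Chain n V),
    m ∈ ms → m.Valid t → m.length = len → m.starter = s →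
      m.value ∈ (acceptChains t len s X ms).1 ∨ 2 ≤ (acceptChains t len s X ms).1.card := by
  induction ms with
  | nil => intro X m h; simp at h
  | cons a ms ih =>
    intro X m hm h1 h2 h3
    rw [acceptChains]
    rcases List.mem_cons.1 hm with rfl | hm
    · split
      · exact Or.inl (subset_acceptChains ms _ (Finset.mem_insert_self _ _))
      · rename_i h
        by_cases hX : m.value ∈ X
        · exact Or.inl (subset_acceptChains ms _ hX)
        · right
          have : 2 ≤ X.card := by
            by_contra hc
            exact h ⟨h1, h2, h3, hX, by omega⟩
          exact this.trans (Finset.card_le_card (subset_acceptChains ms _))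
    · split
      · exact ih _ m hm h1 h2 h3
      · exact ih _ m hm h1 h2 h3

end Accept

/-! ### Chains, certificates and received messages -/

section Chains

variable {n : ℕ} {V : Type u} {t : ℕ}

theorem Chain.valid_start {x : V} {cc : Cert n} {i : Fin n} :
    (Chain.start x cc i).Valid t ↔ IsCert t i cc := by
  simp [Chain.Valid, Chain.links]

theorem Chain.valid_extend {m : Chain n V} {cc : Cert n} {j : Fin n} :
    (Chain.extend m cc j).Valid t ↔
      m.Valid t ∧ IsCert t j cc ∧ j ∉ m.links.map Prod.fst := by
  simp only [Chain.Valid, Chain.links, List.map_append, List.nodup_append, List.mem_append,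
    List.map_cons, List.map_nil, List.mem_singleton]
  constructor
  · rintro ⟨h1, h2, -, h3⟩
    exact ⟨⟨fun l hl => h1 l (Or.inl hl), h2⟩, h1 (j, cc) (Or.inr rfl),
      fun hj => h3 j hj j rfl rfl⟩
  · rintro ⟨⟨h1, h2⟩, h3, h4⟩
    refine ⟨?_, h2, by simp, ?_⟩
    · rintro l (hl | rfl)
      · exact h1 l hl
      · exact h3
    · rintro a ha b rfl rfl
      exact h4 ha

theorem Chain.length_extend (m : Chain n V) (cc : Cert n) (j : Fin n) :
    (Chain.extend m cc j).length = m.length + 1 := by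
  simp [Chain.length, Chain.links]

theorem Chain.cert_signatures_subset (m : Chain n V) : ∀ l ∈ m.links,
    (Cert.signatures l.2 : Set (Signature n V)) ⊆ m.signatures := by
  induction m with
  | start x cc i =>
    intro l hl
    simp only [Chain.links, List.mem_singleton] at hl
    subst hl
    exact Set.subset_insert _ _
  | extend m cc j ih =>
    intro l hl
    simp only [Chain.links, List.mem_append, List.mem_singleton] at hl
    rcases hl with hl | rfl
    · exact (ih l hl).trans (Set.subset_union_right.trans (Set.subset_insert _ _))
    · exact Set.subset_union_left.trans (Set.subset_insert _ _)

theorem Chain.starter_mem_links (m : Chain n V) : m.starter ∈ m.links.map Prod.fst := by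
  induction m with
  | start x cc i => simp [Chain.starter, Chain.links]
  | extend m cc j ih => simp only [Chain.starter, Chain.links, List.map_append]; exact
      List.mem_append_left _ ih

theorem mem_receivedChains {inb : List (Fin n × Message n V)} {m : Chain n V} :
    m ∈ receivedChains inb ↔ ∃ j, (j, Message.chain m) ∈ inb := by
  unfold receivedChains
  rw [List.mem_filterMap]
  constructor
  · rintro ⟨⟨j, p⟩, hp, h⟩
    cases p <;> simp at h
    subst h
    exact ⟨j, hp⟩
  · rintro ⟨j, h⟩
    exact ⟨_, h, rfl⟩

theorem mem_voters {i j : Fin n} {inb : List (Fin n × Message n V)} :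
    j ∈ voters i inb ↔ (j, Message.vote j i) ∈ inb := by
  unfold voters
  rw [List.mem_toFinset, List.mem_filterMap]
  constructor
  · rintro ⟨⟨a, p⟩, hp, h⟩
    cases p <;> simp at h
    obtain ⟨⟨rfl, rfl⟩, rfl⟩ := h
    exact hp
  · intro h
    exact ⟨_, h, by simp⟩

theorem isCert_makeCert {i : Fin n} {S : Finset (Fin n)} (h : t + 1 ≤ S.card) :
    IsCert t i (makeCert t i S) := by
  unfold makeCert
  rw [if_pos h]
  constructor
  · rw [Finset.card_image_of_injective _ (fun a b hab => (Prod.mk.inj hab).1)]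
    rw [List.toFinset_card_of_nodup
      (((List.nodup_finRange n).filter _).sublist (List.take_sublist _ _))]
    rw [List.length_take]
    have : ((List.finRange n).filter fun j => j ∈ S).length = S.card := by
      rw [← List.toFinset_card_of_nodup ((List.nodup_finRange n).filter _)]
      congr 1
      ext l
      simp
    omega
  · intro σ hσ
    obtain ⟨j, -, rfl⟩ := Finset.mem_image.1 hσ
    rfl

theorem mem_makeCert {i : Fin n} {S : Finset (Fin n)} {p : Fin n × Fin n}
    (h : p ∈ makeCert t i S) : p.1 ∈ S ∧ p.2 = i := by
  unfold makeCert at h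
  split at h
  · obtain ⟨j, hj, rfl⟩ := Finset.mem_image.1 h
    have := List.mem_of_mem_take (List.mem_toFinset.1 hj)
    exact ⟨by simpa using this, rfl⟩
  · simp at h

theorem mem_broadcast {m m' : Message n V} {j : Fin n} :
    (j, m') ∈ broadcast m ↔ m' = m := by
  simp [broadcast, eq_comm]

theorem length_broadcast (m : Message n V) : (broadcast m).length = n := by
  simp [broadcast]

/-- Among `t + 1` signers of a certificate one is outside any set of at most `t` parties. -/
theorem IsCert.exists_notMem {F : Finset (Fin n)} {j : Fin n} {cc : Cert n} (h : IsCert t j cc)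
    (hF : F.card ≤ t) : ∃ a, a ∉ F ∧ (a, j) ∈ cc := by
  by_contra! hc
  have hsub : cc ⊆ F.image fun a => (a, j) := by
    rintro ⟨a, b⟩ hab
    obtain rfl : b = j := h.2 _ hab
    refine Finset.mem_image.2 ⟨a, ?_, rfl⟩
    by_contra ha
    exact hc a ha hab
  have := (Finset.card_le_card hsub).trans Finset.card_image_le
  have := h.1
  omega

theorem pluralityFrom_eq_some {inb : List (Fin n × Message n V)} {j : Fin n} {v : V}
    (h : pluralityFrom t inb j = some v) :
    ∃ cc, (j, Message.plurality v cc) ∈ inb ∧ IsCert t j cc := by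
  unfold pluralityFrom at h
  have := List.mem_of_head? h
  rw [List.mem_filterMap] at this
  obtain ⟨⟨a, p⟩, hp, h⟩ := this
  cases p <;> simp at h
  obtain ⟨⟨rfl, hc⟩, rfl⟩ := h
  exact ⟨_, hp, hc⟩

theorem exists_pluralityFrom {inb : List (Fin n × Message n V)} {j : Fin n} {v : V} {cc : Cert n}
    (h : (j, Message.plurality v cc) ∈ inb) (hc : IsCert t j cc) :
    ∃ w, pluralityFrom t inb j = some w := by
  unfold pluralityFrom
  refine ⟨_, List.head?_eq_some_head (List.ne_nil_of_mem (a := v) ?_)⟩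
  exact List.mem_filterMap.2 ⟨_, h, by simp [hc]⟩

end Chains

/-! ### The committee: who can be nominated and who must be -/

section Committee

variable {n : ℕ}

/-- The parties for which a party with classification vector `c` votes. -/
def nominees (k : ℕ) (c : Fin n → Bool) : List (Fin n) := (order c).take (2 * k + 1)

/-- The parties for which some honest party votes. -/
def nominated (k : ℕ) (F : Finset (Fin n)) (c : Fin n → Fin n → Bool) : Finset (Fin n) :=
  Finset.univ.filter fun j => ∃ a, a ∉ F ∧ j ∈ nominees k (c a)

theorem mem_nominated {k : ℕ} {F : Finset (Fin n)} {c : Fin n → Fin n → Bool} {j : Fin n} :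
    j ∈ nominated k F c ↔ ∃ a, a ∉ F ∧ j ∈ nominees k (c a) := by
  simp [nominated]

theorem length_order (c : Fin n → Bool) : (order c).length = n := by
  have := List.length_eq_length_filter_add (l := List.finRange n) (fun j => c j)
  simp only [List.length_finRange] at this
  simp only [order, List.length_append]
  simpa using this.symm

theorem length_nominees_le (k : ℕ) (c : Fin n → Bool) :
    (nominees k c).length ≤ 2 * k + 1 ∧ (nominees k c).length ≤ n := by
  unfold nominees
  rw [List.length_take, length_order]
  omega

variable {k t : ℕ} {F : Finset (Fin n)} {c : Fin n → Fin n → Bool}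

/-- The honest parties that every honest party classifies as honest. -/
def wellClassified (F : Finset (Fin n)) (c : Fin n → Fin n → Bool) : Finset (Fin n) :=
  (F ∪ misclassified F c)ᶜ

theorem classified_of_mem {a j : Fin n} (ha : a ∉ F) (hj : j ∈ wellClassified F c) :
    c a j = true := by
  simp only [wellClassified, misclassified, Finset.mem_compl, Finset.mem_union,
    Finset.mem_filter, Finset.mem_univ, true_and, not_or, not_exists, not_and] at hj
  have := (hj.2 a ha).1 hj.1
  simpa using this

theorem mem_of_classified {a j : Fin n} (ha : a ∉ F) (hj : c a j = true) :
    j ∈ wellClassified F c ∨ j ∈ misclassified F c := by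
  by_contra! h
  have h1 : j ∉ misclassified F c := h.2
  have h2 : j ∈ F := by
    by_contra hF
    exact h.1 (by simp [wellClassified, hF, h1])
  exact h1 (by
    simp only [misclassified, Finset.mem_filter, Finset.mem_univ, true_and]
    exact ⟨a, ha, Or.inr ⟨h2, hj⟩⟩)

theorem card_wellClassified (hF : F.card ≤ t) (hm : (misclassified F c).card ≤ k)
    (hn : 2 * k + 1 + (t + k) ≤ n) : 2 * k + 1 ≤ (wellClassified F c).card := by
  rw [wellClassified, Finset.card_compl, Fintype.card_fin]
  have := Finset.card_union_le F (misclassified F c)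
  omega

/-- The well classified parties alone number at least `2k+1`, so the cut falls inside the first
block of `order`, which is increasing. -/
theorem mem_nominees_iff {a j : Fin n} (hF : F.card ≤ t) (hm : (misclassified F c).card ≤ k)
    (hn : 2 * k + 1 + (t + k) ≤ n) (ha : a ∉ F) :
    j ∈ nominees k (c a) ↔
      c a j = true ∧ (Finset.univ.filter fun l => c a l = true ∧ l < j).card < 2 * k + 1 := by
  have hlen : 2 * k + 1 ≤ ((List.finRange n).filter fun j => c a j = true).length := by
    refine (card_wellClassified hF hm hn).trans ?_
    rw [← List.toFinset_card_of_nodup ((List.nodup_finRange n).filter _)]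
    refine Finset.card_le_card fun l hl => ?_
    simpa using classified_of_mem ha hl
  unfold nominees order
  rw [List.take_append_of_le_length hlen, mem_take_filter_finRange]
  simp

theorem card_take_le (S : Finset (Fin n)) (m : ℕ) :
    (((List.finRange n).filter fun j => j ∈ S).take m).toFinset.card = min m S.card := by
  rw [List.toFinset_card_of_nodup
    (((List.nodup_finRange n).filter _).sublist (List.take_sublist _ _)), List.length_take]
  congr 1
  rw [← List.toFinset_card_of_nodup ((List.nodup_finRange n).filter _)]
  congr 1
  ext l
  simp

theorem card_nominated_le (hF : F.card ≤ t) (hm : (misclassified F c).card ≤ k)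
    (hn : 2 * k + 1 + (t + k) ≤ n) : (nominated k F c).card ≤ 3 * k + 1 := by
  have hsub : nominated k F c ⊆
      (((List.finRange n).filter fun j => j ∈ wellClassified F c).take (2 * k + 1)).toFinset ∪
        misclassified F c := by
    intro j hj
    obtain ⟨a, ha, hj⟩ := mem_nominated.1 hj
    rw [mem_nominees_iff hF hm hn ha] at hj
    rw [Finset.mem_union, List.mem_toFinset, mem_take_filter_finRange]
    refine (mem_of_classified ha hj.1).imp (fun h => ⟨by simpa using h, ?_⟩) id
    -- Well classified parties below `j` are trusted by `a`, so `j` comes no later among the well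
    -- classified parties than in the list of `a`.
    refine lt_of_le_of_lt (Finset.card_le_card fun l hl => ?_) hj.2
    simp only [Finset.mem_filter, Finset.mem_univ, true_and, decide_eq_true_eq] at hl ⊢
    exact ⟨classified_of_mem ha hl.1, hl.2⟩
  have h1 := Finset.card_le_card hsub
  have h2 := Finset.card_union_le
    (((List.finRange n).filter fun j => j ∈ wellClassified F c).take (2 * k + 1)).toFinset
    (misclassified F c)
  rw [card_take_le] at h2
  omega

/-- A nominee is trusted by an honest party; if it is faulty, it is therefore misclassified. -/
theorem card_nominated_inter_le (hF : F.card ≤ t) (hm : (misclassified F c).card ≤ k)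
    (hn : 2 * k + 1 + (t + k) ≤ n) : (nominated k F c ∩ F).card ≤ k := by
  refine (Finset.card_le_card fun j hj => ?_).trans hm
  obtain ⟨hj, hjF⟩ := Finset.mem_inter.1 hj
  obtain ⟨a, ha, hj⟩ := mem_nominated.1 hj
  rw [mem_nominees_iff hF hm hn ha] at hj
  refine (mem_of_classified ha hj.1).resolve_left fun h => ?_
  simp [wellClassified, hjF] at h

/-- There are `k + 1` honest parties for which all honest parties vote. -/
theorem exists_core (hF : F.card ≤ t) (hm : (misclassified F c).card ≤ k)
    (hn : 2 * k + 1 + (t + k) ≤ n) :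
    ∃ K : Finset (Fin n), K.card = k + 1 ∧ (∀ j ∈ K, j ∉ F) ∧
      ∀ a, a ∉ F → ∀ j ∈ K, j ∈ nominees k (c a) := by
  have hG := card_wellClassified hF hm hn
  refine ⟨(((List.finRange n).filter fun j => j ∈ wellClassified F c).take (k + 1)).toFinset,
    ?_, ?_, ?_⟩
  · rw [card_take_le]
    omega
  · intro j hj
    have := List.mem_of_mem_take (List.mem_toFinset.1 hj)
    simp only [wellClassified, Finset.compl_union, Finset.mem_inter, Finset.mem_compl,
      List.mem_filter, decide_eq_true_eq] at this
    exact this.2.1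
  · intro a ha j hj
    rw [List.mem_toFinset, mem_take_filter_finRange] at hj
    rw [mem_nominees_iff hF hm hn ha]
    refine ⟨classified_of_mem ha (by simpa using hj.1), ?_⟩
    -- In the list of `a`, `j` is preceded by at most `k` well classified and at most `k`
    -- misclassified parties, so by fewer than `2k+1`.
    have hsub : (Finset.univ.filter fun l => c a l = true ∧ l < j) ⊆
        (Finset.univ.filter fun l => decide (l ∈ wellClassified F c) = true ∧ l < j) ∪
          misclassified F c := by
      intro l hl
      simp only [Finset.mem_filter, Finset.mem_univ, true_and] at hl
      rw [Finset.mem_union]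
      exact (mem_of_classified ha hl.1).imp (fun h => by simp [h, hl.2]) id
    have h1 := (Finset.card_le_card hsub).trans (Finset.card_union_le _ _)
    omega

end Committee

end AuthBA
namespace AuthBA

open SyncNet

/-! ### Executions: states round by round and the sets `X_i` -/

section Run

variable {V : Type u} [LinearOrder V] {n t k : ℕ} {F : Finset (Fin n)}
  {x : Fin n → V} {c : Fin n → Fin n → Bool}

/-- The executions of the algorithm. -/
abbrev Run (t k : ℕ) (x : Fin n → V) (c : Fin n → Fin n → Bool) (F : Finset (Fin n)) :=
  Execution (algorithm t k x c) F Message.signatures Signature.signer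

namespace Run

variable (E : Run t k x c F)

/-- The set `cc_i`. -/
def cert (i : Fin n) : Cert n := makeCert t i (voters i (E.inbox 0 i))

/-- The chains that `i` accepts at the end of round `r` of the broadcast instance of `s`. -/
def accepted (r : ℕ) (i s : Fin n) : List (Chain n V) :=
  (acceptChains t r s ((E.state r i).X s) (receivedChains (E.inbox r i))).2

theorem mem_inbox {r : ℕ} {i j : Fin n} {m : Message n V} (hi : i ∉ F) :
    (j, m) ∈ E.inbox r i ↔ (i, m) ∈ E.sent r j := by
  rw [(E.delivery r i hi).mem_iff, List.mem_flatMap]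
  constructor
  · rintro ⟨a, -, h⟩
    obtain ⟨⟨b, p⟩, hp, h⟩ := List.mem_map.1 h
    obtain ⟨rfl, rfl⟩ := Prod.mk.inj h
    rw [List.mem_filter] at hp
    obtain ⟨hp, hb⟩ := hp
    obtain rfl : b = i := by simpa using hb
    exact hp
  · intro h
    refine ⟨j, List.mem_finRange j, List.mem_map.2 ⟨(i, m), ?_, rfl⟩⟩
    rw [List.mem_filter]
    exact ⟨h, by simp⟩

theorem sent_eq {i : Fin n} (hi : i ∉ F) (r : ℕ) : E.sent r i = (E.state r i).outbox :=
  E.sent_honest r i hi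

theorem round_eq {i : Fin n} (hi : i ∉ F) (r : ℕ) : (E.state r i).round = r := by
  induction r with
  | zero => rw [E.state_zero i hi]; rfl
  | succ r ih =>
    rw [E.state_succ r i hi]
    simp only [algorithm]
    split_ifs <;> simp [afterVotes, afterRelay, afterLastRelay, afterPlurality, ih]

theorem state_zero_eq {i : Fin n} (hi : i ∉ F) : E.state 0 i = startState k (c i) i :=
  E.state_zero i hi

theorem state_one_eq {i : Fin n} (hi : i ∉ F) :
    E.state 1 i = afterVotes t (x i) i (E.state 0 i) (E.inbox 0 i) := by
  rw [E.state_succ 0 i hi]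
  simp only [algorithm, E.round_eq hi, if_true]

theorem state_relay_eq {i : Fin n} (hi : i ∉ F) {r : ℕ} (h1 : 1 ≤ r) (h2 : r ≤ k) :
    E.state (r + 1) i = afterRelay t i (E.state r i) (E.inbox r i) := by
  rw [E.state_succ r i hi]
  simp only [algorithm, E.round_eq hi]
  rw [if_neg (by omega), if_pos h2]

theorem state_lastRelay_eq {i : Fin n} (hi : i ∉ F) :
    E.state (k + 2) i = afterLastRelay t i (E.state (k + 1) i) (E.inbox (k + 1) i) := by
  rw [E.state_succ (k + 1) i hi]
  simp only [algorithm, E.round_eq hi]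
  rw [if_neg (by omega), if_neg (by omega), if_pos trivial]

theorem state_plurality_eq {i : Fin n} (hi : i ∉ F) :
    E.state (k + 3) i = afterPlurality t (E.state (k + 2) i) (E.inbox (k + 2) i) := by
  rw [E.state_succ (k + 2) i hi]
  simp only [algorithm, E.round_eq hi]
  rw [if_neg (by omega), if_neg (by omega), if_neg (by omega), if_pos trivial]

theorem state_end_eq {i : Fin n} (hi : i ∉ F) {r : ℕ} (hr : k + 3 ≤ r) :
    E.state (r + 1) i = { E.state r i with round := (E.state r i).round + 1 } := by
  rw [E.state_succ r i hi]
  simp only [algorithm, E.round_eq hi]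
  rw [if_neg (by omega), if_neg (by omega), if_neg (by omega), if_neg (by omega)]

theorem cc_eq {i : Fin n} (hi : i ∉ F) {r : ℕ} (hr : 1 ≤ r) : (E.state r i).cc = E.cert i := by
  induction r, hr using Nat.le_induction with
  | base => rw [E.state_one_eq hi]; rfl
  | succ r hr ih =>
    rw [← ih, E.state_succ r i hi]
    simp only [algorithm, E.round_eq hi]
    rw [if_neg (by omega)]
    split_ifs <;> simp [afterRelay, afterLastRelay, afterPlurality]

theorem X_zero {i : Fin n} (hi : i ∉ F) (s : Fin n) : (E.state 0 i).X s = ∅ := by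
  rw [E.state_zero_eq hi]; rfl

theorem X_one {i : Fin n} (hi : i ∉ F) (s : Fin n) :
    (E.state 1 i).X s = if s = i ∧ IsCert t i (E.cert i) then {x i} else ∅ := by
  rw [E.state_one_eq hi]; rfl

theorem X_succ {i : Fin n} (hi : i ∉ F) {r : ℕ} (h1 : 1 ≤ r) (h2 : r ≤ k + 1) (s : Fin n) :
    (E.state (r + 1) i).X s =
      (acceptChains t r s ((E.state r i).X s) (receivedChains (E.inbox r i))).1 := by
  rcases Nat.lt_or_ge k r with h | h
  · obtain rfl : r = k + 1 := by omega
    rw [E.state_lastRelay_eq hi]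
    simp only [afterLastRelay, E.round_eq hi]
  · rw [E.state_relay_eq hi h1 h]
    simp only [afterRelay, E.round_eq hi]

theorem X_end {i : Fin n} (hi : i ∉ F) {r : ℕ} (hr : k + 2 ≤ r) (s : Fin n) :
    (E.state (r + 1) i).X s = (E.state r i).X s := by
  rcases Nat.lt_or_ge (k + 2) r with h | h
  · rw [E.state_end_eq hi h]
  · obtain rfl : r = k + 2 := by omega
    rw [E.state_plurality_eq hi]
    rfl

theorem X_subset_succ {i : Fin n} (hi : i ∉ F) (r : ℕ) (s : Fin n) :
    (E.state r i).X s ⊆ (E.state (r + 1) i).X s := by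
  rcases Nat.eq_zero_or_pos r with rfl | h1
  · rw [E.X_zero hi]; exact Finset.empty_subset _
  · rcases Nat.lt_or_ge (k + 1) r with h | h
    · rw [E.X_end hi h]
    · rw [E.X_succ hi h1 h]
      exact subset_acceptChains _ _

theorem X_mono {i : Fin n} (hi : i ∉ F) {r r' : ℕ} (h : r ≤ r') (s : Fin n) :
    (E.state r i).X s ⊆ (E.state r' i).X s :=
  monotone_nat_of_le_succ (f := fun r => (E.state r i).X s) (fun r => E.X_subset_succ hi r s) h

theorem card_X_le {i : Fin n} (hi : i ∉ F) (r : ℕ) (s : Fin n) :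
    ((E.state r i).X s).card ≤ 2 := by
  induction r with
  | zero => simp [E.X_zero hi]
  | succ r ih =>
    rcases Nat.eq_zero_or_pos r with rfl | h1
    · rw [E.X_one hi]
      split_ifs <;> simp
    · rcases Nat.lt_or_ge (k + 1) r with h | h
      · rwa [E.X_end hi h]
      · rw [E.X_succ hi h1 h]
        exact acceptChains_card_le _ _ ih

/-- Where the elements of `X_i` come from. -/
theorem mem_X {i : Fin n} (hi : i ∉ F) {r : ℕ} {s : Fin n} {v : V}
    (hv : v ∈ (E.state r i).X s) :
    (s = i ∧ IsCert t i (E.cert i) ∧ v = x i) ∨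
      ∃ r', 1 ≤ r' ∧ r' ≤ k + 1 ∧ ∃ m ∈ E.accepted r' i s, m.value = v := by
  induction r with
  | zero => simp [E.X_zero hi] at hv
  | succ r ih =>
    rcases Nat.eq_zero_or_pos r with rfl | h1
    · rw [zero_add, E.X_one hi] at hv
      split_ifs at hv with h
      · exact Or.inl ⟨h.1, h.2, by simpa using hv⟩
      · simp at hv
    · rcases Nat.lt_or_ge (k + 1) r with h | h
      · rw [E.X_end hi h] at hv
        exact ih hv
      · rw [E.X_succ hi h1 h] at hv
        rcases mem_acceptChains_fst _ _ _ hv with hv | hv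
        · exact ih hv
        · exact Or.inr ⟨r, h1, h, hv⟩

theorem accepted_spec {i s : Fin n} (hi : i ∉ F) {r : ℕ} {m : Chain n V}
    (hm : m ∈ E.accepted r i s) :
    (∃ j, (i, Message.chain m) ∈ E.sent r j) ∧ m.Valid t ∧ m.length = r ∧ m.starter = s ∧
      m.value ∉ (E.state r i).X s := by
  obtain ⟨h1, h2, h3, h4, h5, -⟩ := mem_acceptChains _ _ _ hm
  obtain ⟨j, hj⟩ := mem_receivedChains.1 h1
  exact ⟨⟨j, (E.mem_inbox hi).1 hj⟩, h2, h3, h4, h5⟩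

theorem value_mem_X_of_accepted {i s : Fin n} (hi : i ∉ F) {r : ℕ} {m : Chain n V} (h1 : 1 ≤ r)
    (h2 : r ≤ k + 1) (hm : m ∈ E.accepted r i s) : m.value ∈ (E.state (r + 1) i).X s := by
  rw [E.X_succ hi h1 h2]
  exact (mem_acceptChains _ _ _ hm).2.2.2.2.2

/-! ### The messages of the honest parties -/

theorem outbox_zero {i : Fin n} (hi : i ∉ F) :
    (E.state 0 i).outbox = (nominees k (c i)).map fun j => (j, .vote i j) := by
  rw [E.state_zero_eq hi]; rfl

theorem outbox_one {i : Fin n} (hi : i ∉ F) :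
    (E.state 1 i).outbox =
      if IsCert t i (E.cert i) then broadcast (.chain (.start (x i) (E.cert i) i)) else [] := by
  rw [E.state_one_eq hi]; rfl

theorem outbox_relay {i : Fin n} (hi : i ∉ F) {r : ℕ} (h1 : 1 ≤ r) (h2 : r ≤ k) :
    (E.state (r + 1) i).outbox =
      if IsCert t i (E.cert i) then
        (List.finRange n).flatMap fun s =>
          (E.accepted r i s).flatMap fun m => broadcast (.chain (.extend m (E.cert i) i))
      else [] := by
  rw [E.state_relay_eq hi h1 h2]
  simp only [afterRelay, E.round_eq hi, E.cc_eq hi h1]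
  rfl

/-- The value `plurality_i`. -/
def plurality (i : Fin n) : Option V :=
  smallestMode (((List.finRange n).filterMap fun s => bbResult ((E.state (k + 2) i).X s) :
    List V) : Multiset V)

theorem outbox_lastRelay {i : Fin n} (hi : i ∉ F) :
    (E.state (k + 2) i).outbox =
      if IsCert t i (E.cert i) then
        match E.plurality i with
        | some v => broadcast (.plurality v (E.cert i))
        | none => []
      else [] := by
  unfold plurality
  rw [E.state_lastRelay_eq hi]
  simp only [afterLastRelay, E.cc_eq hi (Nat.le_add_left 1 k)]

theorem outbox_end {i : Fin n} (hi : i ∉ F) {r : ℕ} (hr : k + 3 ≤ r) :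
    (E.state r i).outbox = [] := by
  induction r, hr using Nat.le_induction with
  | base => rw [E.state_plurality_eq hi]; rfl
  | succ r hr ih => rw [E.state_end_eq hi hr]; exact ih

theorem mem_sent {i j : Fin n} (hi : i ∉ F) {r : ℕ} {m : Message n V}
    (h : (j, m) ∈ E.sent r i) :
    (r = 0 ∧ j ∈ nominees k (c i) ∧ m = .vote i j) ∨
    (r = 1 ∧ IsCert t i (E.cert i) ∧ m = .chain (.start (x i) (E.cert i) i)) ∨
    (∃ r' s m', 1 ≤ r' ∧ r' ≤ k ∧ r = r' + 1 ∧ IsCert t i (E.cert i) ∧ m' ∈ E.accepted r' i s ∧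
      m = .chain (.extend m' (E.cert i) i)) ∨
    (r = k + 2 ∧ IsCert t i (E.cert i) ∧ ∃ v, E.plurality i = some v ∧
      m = .plurality v (E.cert i)) := by
  rw [E.sent_eq hi] at h
  obtain rfl | rfl | ⟨r', rfl, h1, h2⟩ | rfl | hr :
      r = 0 ∨ r = 1 ∨ (∃ r', r = r' + 1 ∧ 1 ≤ r' ∧ r' ≤ k) ∨ r = k + 2 ∨ k + 3 ≤ r := by
    by_cases h1 : r ≤ 1
    · omega
    · by_cases h2 : r ≤ k + 1
      · exact Or.inr (Or.inr (Or.inl ⟨r - 1, by omega⟩))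
      · omega
  · rw [E.outbox_zero hi] at h
    obtain ⟨a, ha, h⟩ := List.mem_map.1 h
    obtain ⟨rfl, rfl⟩ := Prod.mk.inj h
    exact Or.inl ⟨rfl, ha, rfl⟩
  · rw [E.outbox_one hi] at h
    split_ifs at h with hc
    · exact Or.inr (Or.inl ⟨rfl, hc, mem_broadcast.1 h⟩)
    · simp at h
  · rw [E.outbox_relay hi h1 h2] at h
    split_ifs at h with hc
    · obtain ⟨s, -, h⟩ := List.mem_flatMap.1 h
      obtain ⟨m', hm', h⟩ := List.mem_flatMap.1 h
      exact Or.inr (Or.inr (Or.inl ⟨r', s, m', h1, h2, rfl, hc, hm', mem_broadcast.1 h⟩))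
    · simp at h
  · rw [E.outbox_lastRelay hi] at h
    split_ifs at h with hc
    · split at h
      · rename_i v hv
        exact Or.inr (Or.inr (Or.inr ⟨rfl, hc, v, hv, mem_broadcast.1 h⟩))
      · simp at h
    · simp at h
  · simp [E.outbox_end hi hr] at h

theorem sent_start {i : Fin n} (hi : i ∉ F) (hc : IsCert t i (E.cert i)) (j : Fin n) :
    (j, Message.chain (.start (x i) (E.cert i) i)) ∈ E.sent 1 i := by
  rw [E.sent_eq hi, E.outbox_one hi, if_pos hc]
  exact mem_broadcast.2 rfl

theorem sent_extend {i s : Fin n} (hi : i ∉ F) (hc : IsCert t i (E.cert i)) {r : ℕ} (h1 : 1 ≤ r)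
    (h2 : r ≤ k) {m : Chain n V} (hm : m ∈ E.accepted r i s) (j : Fin n) :
    (j, Message.chain (.extend m (E.cert i) i)) ∈ E.sent (r + 1) i := by
  rw [E.sent_eq hi, E.outbox_relay hi h1 h2, if_pos hc]
  exact List.mem_flatMap.2 ⟨s, List.mem_finRange s,
    List.mem_flatMap.2 ⟨m, hm, mem_broadcast.2 rfl⟩⟩

/-! ### Signatures of honest parties are created only by the code -/

/-- The signature is one that the code of its owner creates. -/
def Legit : Signature n V → Prop
  | .committee a b => b ∈ nominees k (c a)
  | .start i y cc => y = x i ∧ cc = E.cert i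
  | .extend i m cc => cc = E.cert i ∧ ∃ r s, 1 ≤ r ∧ r ≤ k ∧ m ∈ E.accepted r i s

/-- All signatures of honest parties in the set are legitimate. -/
def AllLegit (S : Set (Signature n V)) : Prop := ∀ σ ∈ S, σ.signer ∉ F → E.Legit σ

/-- An honest party builds its certificate from votes received directly from their signers, and
honest signers vote only for their nominees. -/
theorem legit_cert {i : Fin n} (hi : i ∉ F) : E.AllLegit (Cert.signatures (E.cert i)) := by
  rintro σ ⟨⟨a, b⟩, hp, rfl⟩ hσ
  obtain ⟨h1, h2⟩ := mem_makeCert hp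
  dsimp only at h1 h2 hσ ⊢
  subst h2
  rw [mem_voters, E.mem_inbox hi] at h1
  rcases E.mem_sent hσ h1 with ⟨-, h, -⟩ | ⟨-, -, h⟩ | ⟨_, _, _, -, -, -, -, -, h⟩ |
    ⟨-, -, v, -, h⟩
  · exact h
  all_goals cases h

theorem legit_sent (r : ℕ) : ∀ (j : Fin n), ∀ p ∈ E.sent r j,
    E.AllLegit (Message.signatures p.2) := by
  induction r using Nat.strong_induction_on with
  | _ r ih =>
    -- Faulty parties may copy signatures from honest messages of the same round, so honest senders
    -- are settled first, up to and including `r`. A chain they relay arrived one round earlier,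
    -- where `ih` applies.
    have honest : ∀ r' ≤ r, ∀ j, j ∉ F → ∀ p ∈ E.sent r' j,
        E.AllLegit (Message.signatures p.2) := by
      rintro r' hr' j hj ⟨a, m⟩ hp
      rcases E.mem_sent hj hp with ⟨-, h, rfl⟩ | ⟨-, hc, rfl⟩ | ⟨q, s, m', h1, h2, rfl, hc, hm, rfl⟩ |
        ⟨-, -, v, -, rfl⟩
      · rintro σ rfl -
        exact h
      · rintro σ (rfl | hσ) hF
        · exact ⟨rfl, rfl⟩
        · exact E.legit_cert hj σ hσ hF
      · rintro σ (rfl | hσ | hσ) hF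
        · exact ⟨rfl, q, s, h1, h2, hm⟩
        · exact E.legit_cert hj σ hσ hF
        · obtain ⟨⟨b, hb⟩, -⟩ := E.accepted_spec hj hm
          exact ih q (by omega) b _ hb σ hσ hF
      · exact E.legit_cert hj
    intro j p hp
    by_cases hj : j ∈ F
    · intro σ hσ hF
      obtain ⟨r', hr', q, hq, hσ'⟩ := E.unforgeable r j hj p hp σ hσ hF
      exact honest r' hr' _ hF q hq σ hσ' hF
    · exact honest r le_rfl j hj p hp

theorem legit_accepted {i s : Fin n} (hi : i ∉ F) {r : ℕ} {m : Chain n V}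
    (hm : m ∈ E.accepted r i s) : E.AllLegit m.signatures := by
  obtain ⟨⟨j, hj⟩, -⟩ := E.accepted_spec hi hm
  exact E.legit_sent r j _ hj

variable {E} in
theorem AllLegit.of_extend {m : Chain n V} {cc : Cert n} {j : Fin n}
    (h : E.AllLegit (Chain.extend m cc j).signatures) : E.AllLegit m.signatures :=
  fun σ hσ => h σ (Or.inr (Or.inr hσ))

/-- One of the `t+1` signers is honest, and its legitimate signature is a vote for a nominee. -/
theorem mem_nominated_of_cert (hF : F.card ≤ t) {j : Fin n} {cc : Cert n} (hc : IsCert t j cc)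
    (hl : E.AllLegit (Cert.signatures cc)) : j ∈ nominated k F c := by
  obtain ⟨a, ha, haj⟩ := hc.exists_notMem hF
  exact mem_nominated.2 ⟨a, ha, hl _ ⟨_, haj, rfl⟩ ha⟩

theorem mem_nominated_of_signer (hF : F.card ≤ t) {m : Chain n V} (hm : m.Valid t)
    (hl : E.AllLegit m.signatures) {j : Fin n} (hj : j ∈ m.links.map Prod.fst) :
    j ∈ nominated k F c := by
  obtain ⟨l, hl', rfl⟩ := List.mem_map.1 hj
  exact E.mem_nominated_of_cert hF (hm.1 l hl')
    fun σ hσ => hl σ (m.cert_signatures_subset l hl' hσ)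

theorem mem_nominated_of_mem_X (hF : F.card ≤ t) {i s : Fin n} (hi : i ∉ F) {r : ℕ} {v : V}
    (hv : v ∈ (E.state r i).X s) : s ∈ nominated k F c := by
  rcases E.mem_X hi hv with ⟨rfl, hc, -⟩ | ⟨r', -, -, m, hm, -⟩
  · exact E.mem_nominated_of_cert hF hc (E.legit_cert hi)
  · obtain ⟨-, hval, -, rfl, -⟩ := E.accepted_spec hi hm
    exact E.mem_nominated_of_signer hF hval (E.legit_accepted hi hm) m.starter_mem_links

/-- The innermost signature fixes the value, and an honest starter signs only its own input. -/
theorem value_eq_of_starter {m : Chain n V} (hl : E.AllLegit m.signatures)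
    (hs : m.starter ∉ F) : m.value = x m.starter := by
  induction m with
  | start y cc i => exact (hl _ (Or.inl rfl) hs).1
  | extend m cc j ih => exact ih hl.of_extend hs

/-! ### The broadcast instances -/

/-- An honest signer of a chain holds its value. -/
theorem value_mem_X_of_signer {m : Chain n V} (hm : m.Valid t) (hl : E.AllLegit m.signatures)
    {j : Fin n} (hj : j ∉ F) (hjm : j ∈ m.links.map Prod.fst) :
    m.value ∈ (E.state m.length j).X m.starter := by
  induction m with
  | start y cc i =>
    obtain rfl : j = i := by simpa [Chain.links] using hjm
    obtain ⟨rfl, rfl⟩ := hl _ (Or.inl rfl) hj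
    change x j ∈ (E.state 1 j).X j
    rw [E.X_one hj, if_pos ⟨rfl, Chain.valid_start.1 hm⟩]
    exact Finset.mem_singleton_self _
  | extend m cc i ih =>
    have hm' := (Chain.valid_extend.1 hm).1
    rw [Chain.length_extend]
    change m.value ∈ (E.state (m.length + 1) j).X m.starter
    simp only [Chain.links, List.map_append, List.mem_append] at hjm
    rcases hjm with hjm | hjm
    · exact E.X_subset_succ hj _ _ (ih hm' hl.of_extend hjm)
    · obtain rfl : j = i := by simpa using hjm
      -- An honest party extends only chains it has accepted, so the value entered its set when the
      -- shorter chain was processed.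
      obtain ⟨-, r, s, h1, h2, hacc⟩ := hl _ (Or.inl rfl) hj
      obtain ⟨-, -, hr, hs, -⟩ := E.accepted_spec hj hacc
      rw [hr, hs]
      exact E.value_mem_X_of_accepted hj h1 (by omega) hacc

/-- A valid chain received in time is taken into account. -/
theorem value_mem_X_of_sent {i j : Fin n} (hi : i ∉ F) {m : Chain n V} (hm : m.Valid t)
    (h1 : 1 ≤ m.length) (h2 : m.length ≤ k + 1)
    (hs : (i, Message.chain m) ∈ E.sent m.length j) :
    m.value ∈ (E.state (k + 2) i).X m.starter ∨ 2 ≤ ((E.state (k + 2) i).X m.starter).card := by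
  have hsub := E.X_mono hi (show m.length + 1 ≤ k + 2 by omega) m.starter
  have hrec : m ∈ receivedChains (E.inbox m.length i) :=
    mem_receivedChains.2 ⟨j, (E.mem_inbox hi).2 hs⟩
  have := value_mem_acceptChains (s := m.starter) _ ((E.state m.length i).X m.starter) m hrec hm
    rfl rfl
  rw [← E.X_succ hi h1 h2] at this
  exact this.imp (fun h => hsub h) fun h => h.trans (Finset.card_le_card hsub)

/-- The value of a chain signed by an honest party reaches every honest party. -/
theorem value_mem_X_of_honest_signer {m : Chain n V} (hm : m.Valid t)
    (hl : E.AllLegit m.signatures) {i j : Fin n} (hi : i ∉ F) (hj : j ∉ F)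
    (hjm : j ∈ m.links.map Prod.fst) :
    m.value ∈ (E.state (k + 2) i).X m.starter ∨ 2 ≤ ((E.state (k + 2) i).X m.starter).card := by
  induction m with
  | start y cc a =>
    obtain rfl : j = a := by simpa [Chain.links] using hjm
    obtain ⟨rfl, rfl⟩ := hl _ (Or.inl rfl) hj
    exact E.value_mem_X_of_sent hi hm (by simp [Chain.length, Chain.links])
      (by simp [Chain.length, Chain.links]) (E.sent_start hj (Chain.valid_start.1 hm) i)
  | extend m cc a ih =>
    obtain ⟨hm', hc, -⟩ := Chain.valid_extend.1 hm
    simp only [Chain.links, List.map_append, List.mem_append] at hjm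
    rcases hjm with hjm | hjm
    · exact ih hm' hl.of_extend hjm
    · obtain rfl : j = a := by simpa using hjm
      obtain ⟨rfl, r, s, h1, h2, hacc⟩ := hl _ (Or.inl rfl) hj
      obtain ⟨-, -, rfl, -, -⟩ := E.accepted_spec hj hacc
      have hlen := Chain.length_extend m (E.cert j) j
      exact E.value_mem_X_of_sent hi hm (by omega) (by omega)
        (hlen ▸ E.sent_extend hj hc h1 h2 hacc i)

/-- What a party with a certificate accepts reaches every honest party. -/
theorem mem_X_of_mem_X (hF : F.card ≤ t) (hk : (nominated k F c ∩ F).card ≤ k) {i j s : Fin n}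
    (hi : i ∉ F) (hj : j ∉ F) (hc : IsCert t i (E.cert i)) {v : V}
    (hv : v ∈ (E.state (k + 2) i).X s) :
    v ∈ (E.state (k + 2) j).X s ∨ 2 ≤ ((E.state (k + 2) j).X s).card := by
  rcases E.mem_X hi hv with ⟨rfl, -, rfl⟩ | ⟨r, h1, h2, m, hm, rfl⟩
  · exact E.value_mem_X_of_sent (m := .start (x s) (E.cert s) s) hj (Chain.valid_start.2 hc)
      (by simp [Chain.length, Chain.links]) (by simp [Chain.length, Chain.links])
      (E.sent_start hi hc j)
  · obtain ⟨-, hval, rfl, rfl, hnot⟩ := E.accepted_spec hi hm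
    have hl := E.legit_accepted hi hm
    rcases Nat.lt_or_ge k m.length with h | h
    -- No round is left for relaying, but more than `k` different nominated signers include an
    -- honest one.
    · obtain ⟨a, ha, haF⟩ : ∃ a ∈ m.links.map Prod.fst, a ∉ F := by
        by_contra! hall
        have hsub : (m.links.map Prod.fst).toFinset ⊆ nominated k F c ∩ F := fun a ha =>
          Finset.mem_inter.2 ⟨E.mem_nominated_of_signer hF hval hl (List.mem_toFinset.1 ha),
            hall a (List.mem_toFinset.1 ha)⟩
        have := Finset.card_le_card hsub
        rw [List.toFinset_card_of_nodup hval.2, List.length_map] at this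
        change m.length ≤ _ at this
        omega
      exact E.value_mem_X_of_honest_signer hval hl hj haF ha
    -- Had `i` signed `m`, it would have held the value before processing `m` and would not have
    -- accepted it. So the extension by `i` is again valid.
    · have hnew : i ∉ m.links.map Prod.fst := fun hmem =>
        hnot (E.value_mem_X_of_signer hval hl hi hmem)
      have hlen := Chain.length_extend m (E.cert i) i
      exact E.value_mem_X_of_sent (m := .extend m (E.cert i) i) hj
        (Chain.valid_extend.2 ⟨hval, hc, hnew⟩) (by omega) (by omega)
        (hlen ▸ E.sent_extend hi hc h1 h hm j)

theorem bbResult_eq (hF : F.card ≤ t) (hk : (nominated k F c ∩ F).card ≤ k) {i j : Fin n}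
    (hi : i ∉ F) (hj : j ∉ F) (hci : IsCert t i (E.cert i)) (hcj : IsCert t j (E.cert j))
    (s : Fin n) :
    bbResult ((E.state (k + 2) i).X s) = bbResult ((E.state (k + 2) j).X s) :=
  bbResult_congr (fun _ hv => E.mem_X_of_mem_X hF hk hi hj hci hv)
    fun _ hv => E.mem_X_of_mem_X hF hk hj hi hcj hv

theorem eq_of_mem_X {i s : Fin n} (hi : i ∉ F) (hs : s ∉ F) {r : ℕ} {v : V}
    (hv : v ∈ (E.state r i).X s) : v = x s := by
  rcases E.mem_X hi hv with ⟨rfl, -, rfl⟩ | ⟨r', -, -, m, hm, rfl⟩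
  · rfl
  · obtain ⟨-, -, -, rfl, -⟩ := E.accepted_spec hi hm
    exact E.value_eq_of_starter (E.legit_accepted hi hm) hs

/-- In the instance of an honest sender with a certificate, its input is the result. -/
theorem bbResult_honest {i s : Fin n} (hi : i ∉ F) (hs : s ∉ F) (hc : IsCert t s (E.cert s)) :
    bbResult ((E.state (k + 2) i).X s) = some (x s) := by
  rw [bbResult_eq_some_iff]
  have hsub : (E.state (k + 2) i).X s ⊆ {x s} := fun v hv =>
    Finset.mem_singleton.2 (E.eq_of_mem_X hi hs hv)
  refine Finset.Subset.antisymm hsub (Finset.singleton_subset_iff.2 ?_)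
  have := E.value_mem_X_of_sent (m := .start (x s) (E.cert s) s) hi (Chain.valid_start.2 hc)
      (by simp [Chain.length, Chain.links]) (by simp [Chain.length, Chain.links])
      (E.sent_start hs hc i)
  refine this.resolve_right fun h => ?_
  have h' := Finset.card_le_card hsub
  simp only [Chain.starter, Finset.card_singleton] at h h'
  omega

/-! ### Termination, agreement and unanimity -/

/-- The value returned by `i`. -/
def decision (i : Fin n) : Option V :=
  smallestMode (((List.finRange n).filterMap (pluralityFrom t (E.inbox (k + 2) i)) :
    List V) : Multiset V)

theorem returnsAt_decision {i : Fin n} (hi : i ∉ F) :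
    E.ReturnsAt i (k + 3) (E.decision i) := by
  constructor
  · intro r hr
    change (E.state r i).result = none
    induction r with
    | zero => rw [E.state_zero_eq hi]; rfl
    | succ r ih =>
      have ih := ih (by omega)
      rcases Nat.eq_zero_or_pos r with rfl | h1
      · rw [E.state_one_eq hi]; exact ih
      · rcases Nat.lt_or_ge k r with h | h
        · obtain rfl : r = k + 1 := by omega
          rw [E.state_lastRelay_eq hi]; exact ih
        · rw [E.state_relay_eq hi h1 h]; exact ih
  · intro r hr
    change (E.state r i).result = some (E.decision i)
    induction r, hr using Nat.le_induction with
    | base => rw [E.state_plurality_eq hi]; rfl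
    | succ r hr ih => rw [E.state_end_eq hi hr]; exact ih

/-- The honest voters alone number at least `n - t ≥ t + 1`. -/
theorem isCert_of_voted (hF : F.card ≤ t) (hn : 2 * t < n) {j : Fin n} (hj : j ∉ F)
    (hv : ∀ a, a ∉ F → j ∈ nominees k (c a)) : IsCert t j (E.cert j) := by
  apply isCert_makeCert
  have hsub : Fᶜ ⊆ voters j (E.inbox 0 j) := by
    intro a ha
    have ha := Finset.mem_compl.1 ha
    rw [mem_voters, E.mem_inbox hj, E.sent_eq ha, E.outbox_zero ha]
    exact List.mem_map.2 ⟨j, hv a ha, rfl⟩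
  have := Finset.card_le_card hsub
  rw [Finset.card_compl, Fintype.card_fin] at this
  omega

theorem agreement (hF : F.card ≤ t) (hm : (misclassified F c).card ≤ k)
    (hn : 2 * k + 1 + (t + k) ≤ n) (hn' : 2 * t < n) :
    ∃ w : V, (∀ i, i ∉ F → E.decision i = some w) ∧
      ∀ v : V, (∀ i, i ∉ F → x i = v) → w = v := by
  obtain ⟨K, hK, hKF, hKv⟩ := exists_core hF hm hn
  have hk := card_nominated_inter_le hF hm hn
  have hKc : ∀ j ∈ K, IsCert t j (E.cert j) := fun j hj =>
    E.isCert_of_voted hF hn' (hKF j hj) fun a ha => hKv a ha j hj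
  obtain ⟨j₀, hj₀⟩ : K.Nonempty := Finset.card_pos.1 (by omega)
  have hj₀F := hKF j₀ hj₀
  obtain ⟨w, hw⟩ : ∃ w, E.plurality j₀ = some w := by
    refine exists_smallestMode (w := x j₀) (Multiset.mem_coe.2 (List.mem_filterMap.2
      ⟨j₀, List.mem_finRange _, E.bbResult_honest hj₀F hj₀F (hKc j₀ hj₀)⟩))
  have hwall : ∀ i, i ∉ F → IsCert t i (E.cert i) → E.plurality i = some w := by
    intro i hi hc
    rw [← hw]
    unfold plurality
    congr 3
    funext s
    exact E.bbResult_eq hF hk hi hj₀F hc (hKc j₀ hj₀) s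
  refine ⟨w, fun i hi => ?_, fun v hv => ?_⟩
  · have hhonest : ∀ j, j ∉ F → ∀ v, pluralityFrom t (E.inbox (k + 2) i) j = some v → v = w := by
      intro j hj v hv
      obtain ⟨cc, hmem, -⟩ := pluralityFrom_eq_some hv
      rw [E.mem_inbox hi] at hmem
      rcases E.mem_sent hj hmem with ⟨-, -, h⟩ | ⟨-, -, h⟩ | ⟨_, _, _, -, -, -, -, -, h⟩ |
        ⟨-, hc, u, hu, h⟩
      · cases h
      · cases h
      · cases h
      · rw [hwall j hj hc] at hu
        cases h
        exact (Option.some.inj hu).symm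
    -- The `k+1` members of `K` all send `w`; a different value needs a faulty sender with a
    -- certificate, hence a faulty nominee.
    refine smallestMode_filterMap_eq (k := k) _ w K (nominated k F c ∩ F) ?_ (by omega) ?_ hk
    · intro j hj
      have hjF := hKF j hj
      have hmem : (j, Message.plurality w (E.cert j)) ∈ E.inbox (k + 2) i := by
        rw [E.mem_inbox hi, E.sent_eq hjF, E.outbox_lastRelay hjF, if_pos (hKc j hj),
          hwall j hjF (hKc j hj)]
        exact mem_broadcast.2 rfl
      obtain ⟨u, hu⟩ := exists_pluralityFrom hmem (hKc j hj)
      rw [hu, hhonest j hjF u hu]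
    · intro j v hv hvw
      obtain ⟨cc, hmem, hc⟩ := pluralityFrom_eq_some hv
      rw [E.mem_inbox hi] at hmem
      exact Finset.mem_inter.2 ⟨E.mem_nominated_of_cert hF hc (E.legit_sent _ _ _ hmem),
        by_contra fun hj => hvw (hhonest j hj v hv)⟩
  · have : E.plurality j₀ = some v := by
      -- The same count, now over instances: those with sender in `K` yield `v`, and another value
      -- requires a faulty nominated sender.
      refine smallestMode_filterMap_eq (k := k) _ v K (nominated k F c ∩ F) ?_ (by omega) ?_ hk
      · intro s hs
        rw [E.bbResult_honest hj₀F (hKF s hs) (hKc s hs), hv s (hKF s hs)]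
      · intro s u hu huv
        rw [bbResult_eq_some_iff] at hu
        have hmem : u ∈ (E.state (k + 2) j₀).X s := hu ▸ Finset.mem_singleton_self u
        refine Finset.mem_inter.2 ⟨E.mem_nominated_of_mem_X hF hj₀F hmem, ?_⟩
        by_contra hs
        exact huv ((E.eq_of_mem_X hj₀F hs hmem).trans (hv s hs))
    rw [hw] at this
    exact Option.some.inj this

/-! ### The number of messages -/

theorem sum_card_X_succ {i : Fin n} (hi : i ∉ F) {r : ℕ} (h1 : 1 ≤ r) (h2 : r ≤ k + 1) :
    ∑ s, ((E.state (r + 1) i).X s).card =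
      ∑ s, ((E.state r i).X s).card + ∑ s, (E.accepted r i s).length := by
  rw [← Finset.sum_add_distrib]
  refine Finset.sum_congr rfl fun s _ => ?_
  rw [E.X_succ hi h1 h2, acceptChains_card]
  rfl

theorem length_outbox_relay_le {i : Fin n} (hi : i ∉ F) {r : ℕ} (h1 : 1 ≤ r) (h2 : r ≤ k) :
    (E.state (r + 1) i).outbox.length ≤
      if IsCert t i (E.cert i) then n * ∑ s, (E.accepted r i s).length else 0 := by
  rw [E.outbox_relay hi h1 h2]
  split_ifs
  · rw [List.length_flatMap]
    simp only [List.length_flatMap, length_broadcast, List.map_const', List.sum_replicate,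
      smul_eq_mul]
    rw [← List.ofFn_eq_map, List.sum_ofFn, Finset.mul_sum]
    exact Finset.sum_le_sum fun s _ => (mul_comm _ _).le
  · simp

/-- The messages sent so far and those waiting to be sent are paid for by the votes, the elements of
the sets `X_i`, and the broadcast of `plurality_i`. -/
theorem messagesSent_add_outbox_le {i : Fin n} (hi : i ∉ F) (r : ℕ) :
    E.messagesSent i r + (E.state r i).outbox.length ≤ (nominees k (c i)).length +
      if IsCert t i (E.cert i) then
        n * (∑ s, ((E.state r i).X s).card + if k + 2 ≤ r then 1 else 0) else 0 := by
  induction r with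
  | zero => simp [Execution.messagesSent, E.outbox_zero hi]
  | succ r ih =>
    have hstep : E.messagesSent i (r + 1) = E.messagesSent i r + (E.state r i).outbox.length := by
      rw [Execution.messagesSent, Finset.sum_range_succ, E.sent_eq hi]
      rfl
    rw [hstep]
    have hmono : ∑ s, ((E.state r i).X s).card ≤ ∑ s, ((E.state (r + 1) i).X s).card :=
      Finset.sum_le_sum fun s _ => Finset.card_le_card (E.X_subset_succ hi r s)
    rcases Nat.eq_zero_or_pos r with rfl | h1
    -- The broadcast that starts a chain is paid for by the input that `i` puts into its own set.
    · have hout : (E.state (0 + 1) i).outbox.length ≤ if IsCert t i (E.cert i) then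
          n * ∑ s, ((E.state (0 + 1) i).X s).card else 0 := by
        rw [zero_add, E.outbox_one hi]
        split_ifs with hc
        · rw [length_broadcast]
          refine Nat.le_mul_of_pos_right _ ?_
          refine Finset.sum_pos' (fun _ _ => Nat.zero_le _) ⟨i, Finset.mem_univ i, ?_⟩
          rw [E.X_one hi, if_pos ⟨rfl, hc⟩]
          simp
        · simp
      have h0 : E.messagesSent i 0 + (E.state 0 i).outbox.length =
          (nominees k (c i)).length := by
        simp [Execution.messagesSent, E.outbox_zero hi]
      rw [h0]
      refine Nat.add_le_add_left (hout.trans ?_) _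
      split_ifs <;> first | omega | exact Nat.mul_le_mul_left _ (Nat.le_add_right _ _)
    · rcases Nat.lt_or_ge k r with h | h
      · rcases Nat.lt_or_ge (k + 1) r with h' | h'
        · have hout : (E.state (r + 1) i).outbox = [] := E.outbox_end hi (by omega)
          rw [hout]
          refine ih.trans (Nat.add_le_add_left ?_ _)
          rw [if_pos (show k + 2 ≤ r by omega), if_pos (show k + 2 ≤ r + 1 by omega)]
          split_ifs
          · exact Nat.mul_le_mul_left _ (by omega)
          · exact le_rfl
        · obtain rfl : r = k + 1 := by omega
          have hout : (E.state (k + 2) i).outbox.length ≤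
              if IsCert t i (E.cert i) then n else 0 := by
            rw [E.outbox_lastRelay hi]
            split_ifs
            · split
              · rw [length_broadcast]
              · simp
            · simp
          refine (Nat.add_le_add ih hout).trans ?_
          rw [if_neg (show ¬ k + 2 ≤ k + 1 by omega), if_pos (show k + 2 ≤ k + 1 + 1 by omega)]
          rw [add_assoc]
          refine Nat.add_le_add_left ?_ _
          split_ifs
          · rw [← Nat.mul_succ]
            exact Nat.mul_le_mul_left _ (by omega)
          · exact le_rfl
      · refine (Nat.add_le_add ih (E.length_outbox_relay_le hi h1 h)).trans ?_
        rw [if_neg (show ¬ k + 2 ≤ r by omega), if_neg (show ¬ k + 2 ≤ r + 1 by omega), add_assoc,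
          E.sum_card_X_succ hi h1 (by omega)]
        refine Nat.add_le_add_left ?_ _
        split_ifs
        · rw [← Nat.mul_add]
          exact Nat.mul_le_mul_left _ (by omega)
        · exact le_rfl

/-- A bound on the number of messages in terms of the number of instances in which a value occurs. -/
theorem messagesSent_le {i : Fin n} (hi : i ∉ F) (R : ℕ) (N : Finset (Fin n))
    (hN : ∀ s v, v ∈ (E.state R i).X s → s ∈ N) :
    E.messagesSent i R ≤ (nominees k (c i)).length +
      if IsCert t i (E.cert i) then n * (2 * N.card + 1) else 0 := by
  refine (Nat.le_add_right _ _).trans ((E.messagesSent_add_outbox_le hi R).trans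
    (Nat.add_le_add_left ?_ _))
  have hsum : ∑ s, ((E.state R i).X s).card ≤ 2 * N.card := by
    rw [← Finset.sum_subset (Finset.subset_univ N) fun s _ hs => by
      rw [Finset.card_eq_zero, Finset.eq_empty_iff_forall_notMem]
      exact fun v hv => hs (hN s v hv)]
    refine (Finset.sum_le_card_nsmul _ _ 2 fun s _ => E.card_X_le hi R s).trans ?_
    rw [smul_eq_mul, mul_comm]
  split_ifs <;> first | exact Nat.mul_le_mul_left _ (by omega) | exact le_rfl

/-- Counting all `n` instances gives `n + n(2n+1) ≤ 4n²`; the constant 50 is shared with the bound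
on the total. -/
theorem messagesSent_le_sq {i : Fin n} (hi : i ∉ F) (R : ℕ) :
    E.messagesSent i R ≤ 50 * n ^ 2 := by
  have h := E.messagesSent_le hi R Finset.univ fun s _ _ => Finset.mem_univ s
  rw [Finset.card_univ, Fintype.card_fin] at h
  have hl := (length_nominees_le k (c i)).2
  have hn : 1 ≤ n := i.pos
  split_ifs at h <;> nlinarith

theorem sum_messagesSent_le (hF : F.card ≤ t) (hm : (misclassified F c).card ≤ k)
    (hn : 2 * k + 1 + (t + k) ≤ n) (R : ℕ) :
    ∑ i ∈ Fᶜ, E.messagesSent i R ≤ 50 * (n * (max k 1) ^ 2) := by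
  have hN := card_nominated_le hF hm hn
  -- Only nominees can hold a certificate. Each holder makes at most two broadcasts per nominated
  -- instance and one of its plurality: `2(3k+1) + 1 = 6k + 3`.
  have hle : ∀ i ∈ Fᶜ, E.messagesSent i R ≤
      (2 * k + 1) + if i ∈ nominated k F c then n * (6 * k + 3) else 0 := by
    intro i hi
    have hi := Finset.mem_compl.1 hi
    have h := E.messagesSent_le hi R (nominated k F c) fun s v hv =>
      E.mem_nominated_of_mem_X hF hi hv
    refine h.trans (Nat.add_le_add (length_nominees_le k (c i)).1 ?_)
    split_ifs with h1 h2
    · exact Nat.mul_le_mul_left _ (by omega)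
    · exact absurd (E.mem_nominated_of_cert hF h1 (E.legit_cert hi)) h2
    · exact Nat.zero_le _
    · exact le_rfl
  have hsum : ∑ i ∈ Fᶜ, E.messagesSent i R ≤ n * (2 * k + 1) + (3 * k + 1) * (n * (6 * k + 3)) := by
    refine (Finset.sum_le_sum hle).trans ((Finset.sum_le_sum_of_subset
      (Finset.subset_univ _)).trans ?_)
    rw [Finset.sum_add_distrib, Finset.sum_const, Finset.card_univ, Fintype.card_fin, smul_eq_mul,
      ← Finset.sum_filter, Finset.sum_const, smul_eq_mul]
    refine Nat.add_le_add_left (Nat.mul_le_mul_right _ ?_) _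
    refine (Finset.card_le_card fun j hj => ?_).trans hN
    exact (Finset.mem_filter.1 hj).2
  refine hsum.trans ?_
  obtain ⟨m, hm⟩ : ∃ m, m = max k 1 := ⟨_, rfl⟩
  rw [← hm]
  have h1 : 1 ≤ m := hm ▸ le_max_right _ _
  have h2 : k ≤ m := hm ▸ le_max_left _ _
  -- With `k ≤ m` and `1 ≤ m`, the coefficient is at most `3m + 36m² ≤ 39m²`, so 50 is not tight.
  calc n * (2 * k + 1) + (3 * k + 1) * (n * (6 * k + 3))
      ≤ n * (3 * m) + (4 * m) * (n * (9 * m)) := by gcongr <;> omega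
    _ = n * (3 * m + 36 * (m * m)) := by ring
    _ ≤ n * (50 * (m * m)) := Nat.mul_le_mul_left _ (by nlinarith)
    _ = 50 * (n * m ^ 2) := by ring

end Run

end Run

end AuthBA

/-- `ReturnsAt i r (some v)` means that `i` returns the value `v` at the end of round `r`. -/
theorem theorem7p8 :
    ∃ C : ℕ, ∀ (V : Type u) [LinearOrder V] (n t k : ℕ) (F : Finset (Fin n))
      (x : Fin n → V) (c : Fin n → Fin n → Bool)
      (E : SyncNet.Execution (AuthBA.algorithm t k x c) F
        AuthBA.Message.signatures AuthBA.Signature.signer),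
      F.card ≤ t →
      ((AuthBA.misclassified F c).card ≤ k → 2 * k + 1 + (t + k) ≤ n → 2 * t < n →
        -- Agreement and termination
        (∃ v : V, ∀ i, i ∉ F → E.ReturnsAt i (k + 3) (some v)) ∧
        -- Strong unanimity
        (∀ v : V, (∀ i, i ∉ F → x i = v) → ∀ i, i ∉ F → E.ReturnsAt i (k + 3) (some v)) ∧
        -- Total number of messages sent by honest parties
        (∀ R : ℕ, ∑ i ∈ Fᶜ, E.messagesSent i R ≤ C * (n * (max k 1) ^ 2))) ∧
      -- Unconditional bounds
      (∀ i, i ∉ F →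
        (∃ o : Option V, E.ReturnsAt i (k + 3) o) ∧
        (∀ R : ℕ, E.messagesSent i R ≤ C * n ^ 2)) := by
  refine ⟨50, fun V _ n t k F x c E hF => ⟨fun hm hn hn' => ?_, fun i hi => ?_⟩⟩
  · obtain ⟨w, hw, hu⟩ := AuthBA.Run.agreement E hF hm hn hn'
    have hret : ∀ i, i ∉ F → E.ReturnsAt i (k + 3) (some w) := fun i hi =>
      hw i hi ▸ AuthBA.Run.returnsAt_decision E hi
    refine ⟨⟨w, hret⟩, fun v hv i hi => ?_, AuthBA.Run.sum_messagesSent_le E hF hm hn⟩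
    rw [← hu v hv]
    exact hret i hi
  · exact ⟨⟨_, AuthBA.Run.returnsAt_decision E hi⟩, AuthBA.Run.messagesSent_le_sq E hi⟩
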